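/- For each $n\ge 1$ let $(\mathfrak X_{n,i},\mathcal A_{n,i},\mu_{n,i})$, $i=1,\dots,n$, be $\sigma$-finite measure spaces. Let $\Theta$ be a set and, for $\theta\in\Theta$, let $p^{(n)}_{\theta}=(p_{\theta,n,1},\dots,p_{\theta,n,n})$, where $p_{\theta,n,i}$ is a probability density with respect to $\mu_{n,i}$; let $P_\theta^{(n)}$ be the product measure on $\prod_{i=1}^n\mathfrak X_{n,i}$ with density $\prod_{i=1}^n p_{\theta,n,i}(x_i)$ relative to $\bigotimes_{i=1}^n\mu_{n,i}$. (An independent, not necessarily identically distributed sequence is the case in which $\mathfrak X_{n,i},\mu_{n,i},p_{\theta,n,i}$ do not depend on $n$.) For nonnegative integrable functions $f,g$ put $h^2(f,g)=\int(\sqrt f-\sqrt g)^2\,d\mu$, and for $n$-tuples $p=(p_1,\dots,p_n)$, $q=(q_1,\dots,q_n)$ of densities put $d_n^2(p,q)=\frac1n\sum_{i=1}^n h^2(p_i,q_i)$. For $\varepsilon\in\mathbb R$ and $\Theta'\subset\Theta$, a componentwise Hellinger upper $\varepsilon$-bracketing of $\Theta'$ of size $N$ is a family of nonnegative $\mu_{n,i}$-integrable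 functions $u_{j,i}$, $1\le j\le N$, $1\le i\le n$, such that for every $\theta\in\Theta'$ there is a $j$ with $p_{\theta,n,i}\le u_{j,i}$ for all $i=1,\dots,n$ and $\sum_{i=1}^n h^2(p_{\theta,n,i},u_{j,i})\le n\varepsilon^2$. Let $N_\uparrow^{n\otimes}(\varepsilon,\Theta',d_n)\in\{0,1,\dots,\infty\}$ be the smallest size of such a bracketing. **Theorem 8.** Let $\Theta_1\subset\Theta_2\subset\cdots$ be subsets of $\Theta$ with $\bigcup_n\Theta_n=\Theta$, and let $\theta_0\in\Theta$. Let $\varepsilon_n\to0$ be a real sequence with $n\varepsilon_n^2\to\infty$ and $$\log N_\uparrow^{n\otimes}(\varepsilon_n,\Theta_n,d_n)\le n\varepsilon_n^2\qquad\text{for all } n\ge 1.$$ For each $n\ge 1$ let $(u^{(n)}_{j,i})$ be a componentwise Hellinger upper $\varepsilon_n$-bracketing of $\Theta_n$ of the minimal size $N_n=N_\uparrow^{n\otimes}(\varepsilon_n,\Theta_n,d_n)$, and let the prior $\Pi_n$ assign mass $1/N_n$ to each of the product densities $p^{(n)}_j=\bigotimes_{i=1}^n\bigl(u^{(n)}_{j,i}/\int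 u^{(n)}_{j,i}\,d\mu_{n,i}\bigr)$, $j=1,\dots,N_n$. Let $\Pi_n(B\mid X^{(n)})=\int_B p(X^{(n)})\,d\Pi_n(p)\big/\int p(X^{(n)})\,d\Pi_n(p)$ be the posterior distribution given the observation $X^{(n)}=(X_1,\dots,X_n)$. Then there is an $M_0$ such that for all $M\ge M_0$, as $n\to\infty$, $$\int \Pi_n\bigl(p^{(n)}: d_n^2(p^{(n)}_{\theta_0},p^{(n)})\ge M\varepsilon_n^2\,\big|\,X^{(n)}\bigr)\,dP^{(n)}_{\theta_0}\longrightarrow 0 .$$ -/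

import Mathlib

open MeasureTheory Filter Topology
open scoped ENNReal

namespace FiniteSieve

noncomputable section

/-- `f` is a probability density relative to `μ`. -/
structure IsProbDensity {X : Type*} [MeasurableSpace X] (μ : Measure X) (f : X → ℝ) : Prop where
  measurable : Measurable f
  nonneg : ∀ x, 0 ≤ f x
  integrable : Integrable f μ
  integral_eq_one : ∫ x, f x ∂μ = 1

/-- The squared Hellinger distance `h²(f, g) = ∫ (√f - √g)² dμ` of two nonnegative integrable
functions. -/
def hellingerSq {X : Type*} [MeasurableSpace X] (μ : Measure X) (f g : X → ℝ) : ℝ :=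
  ∫ x, (√(f x) - √(g x)) ^ 2 ∂μ

/-- A density of product form on `∏ i, X i`, given by its component densities. -/
def ProductDensity {n : ℕ} (X : Fin n → Type*) : Type _ := (i : Fin n) → X i → ℝ

/-- The finitely supported priors below are defined on all sets of product densities. -/
instance {n : ℕ} (X : Fin n → Type*) : MeasurableSpace (ProductDensity X) := ⊤

/-- The joint density `(x₁, …, xₙ) ↦ ∏ i, q i (x i)`. -/
def ProductDensity.joint {n : ℕ} {X : Fin n → Type*} (q : ProductDensity X)
    (x : (i : Fin n) → X i) : ℝ := ∏ i, q i (x i)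

/-- The product probability measure `⊗ i, q i · μ i`. -/
def ProductDensity.law {n : ℕ} {X : Fin n → Type*} [∀ i, MeasurableSpace (X i)]
    (μ : (i : Fin n) → Measure (X i)) (q : ProductDensity X) : Measure ((i : Fin n) → X i) :=
  Measure.pi fun i => (μ i).withDensity fun x => ENNReal.ofReal (q i x)

/-- `dₙ²`, the average of the squared Hellinger distances of the components. -/
def avgHellingerSq {n : ℕ} {X : Fin n → Type*} [∀ i, MeasurableSpace (X i)]
    (μ : (i : Fin n) → Measure (X i)) (q r : ProductDensity X) : ℝ :=
  (1 / (n : ℝ)) * ∑ i, hellingerSq (μ i) (q i) (r i)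

/-- `u j i`, `j = 1, …, N`, `i = 1, …, n`, is a componentwise Hellinger upper `ε`-bracketing
of the product densities `p θ`, `θ ∈ S`. -/
structure IsUpperBracketing {Θ : Type*} {n : ℕ} {X : Fin n → Type*} [∀ i, MeasurableSpace (X i)]
    (μ : (i : Fin n) → Measure (X i)) (p : Θ → ProductDensity X) (ε : ℝ) (S : Set Θ)
    {N : ℕ} (u : Fin N → (i : Fin n) → X i → ℝ) : Prop where
  measurable : ∀ j i, Measurable (u j i)
  nonneg : ∀ j i x, 0 ≤ u j i x
  integrable : ∀ j i, Integrable (u j i) (μ i)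
  covers : ∀ θ ∈ S, ∃ j, (∀ i x, p θ i x ≤ u j i x) ∧
    ∑ i, hellingerSq (μ i) (p θ i) (u j i) ≤ n * ε ^ 2

/-- The componentwise Hellinger upper bracketing number: the smallest size of a componentwise
Hellinger upper `ε`-bracketing (`⊤` if there is no finite one). -/
def upperBracketingNumber {Θ : Type*} {n : ℕ} {X : Fin n → Type*} [∀ i, MeasurableSpace (X i)]
    (μ : (i : Fin n) → Measure (X i)) (p : Θ → ProductDensity X) (ε : ℝ) (S : Set Θ) : ℕ∞ :=
  ⨅ (N : ℕ) (_ : ∃ u : Fin N → (i : Fin n) → X i → ℝ, IsUpperBracketing μ p ε S u), (N : ℕ∞)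

/-- The renormalized product bracket with components `u i / ∫ u i dμ i`. -/
def renormalize {n : ℕ} {X : Fin n → Type*} [∀ i, MeasurableSpace (X i)]
    (μ : (i : Fin n) → Measure (X i)) (u : (i : Fin n) → X i → ℝ) : ProductDensity X :=
  fun i x => u i x / ∫ y, u i y ∂(μ i)

/-- The prior that assigns mass `1 / N` to each of the `N` renormalized upper product brackets. -/
def bracketPrior {n : ℕ} {X : Fin n → Type*} [∀ i, MeasurableSpace (X i)]
    (μ : (i : Fin n) → Measure (X i)) {N : ℕ} (u : Fin N → (i : Fin n) → X i → ℝ) :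
    Measure (ProductDensity X) :=
  (N : ℝ≥0∞)⁻¹ • ∑ j, Measure.dirac (renormalize μ (u j))

/-- Bayes' formula: the posterior mass of `B` given the observation `x`, for the prior `Q`. -/
def posterior {n : ℕ} {X : Fin n → Type*} (Q : Measure (ProductDensity X))
    (B : Set (ProductDensity X)) (x : (i : Fin n) → X i) : ℝ≥0∞ :=
  (∫⁻ q in B, ENNReal.ofReal (q.joint x) ∂Q) / ∫⁻ q, ENNReal.ofReal (q.joint x) ∂Q

end

end FiniteSieve

namespace FiniteSieve

/-! ### Hellinger estimates on a single component -/

variable {α : Type*} [MeasurableSpace α] {m : Measure α}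

/-! Let `k` be a bracket covering `θ₀`. The uniform prior weights cancel in Bayes' formula, and
since a posterior mass is at most `1`, candidate `j` has mass at most the fourth root of its
likelihood ratio against `k`. No lower bound on the evidence beyond the `k`-th term is needed. Under
the true law the expectation of this root factorizes over components. In each one, Cauchy–Schwarz
separates the affinity of the truth `p` with the candidate `q`, which gives `exp (-h²(p,q)/4)`, from
a half moment of the ratio of `p` to the renormalized bracket, which costs `exp (3/4 h²(p,u))`
(`integral_mul_sqrt_div_le_exp`). That this cost is quadratic in `h` is the crux: the bracket's
excess mass may be of order `h`, but it cancels to first order. Summing over the at most `exp (n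
ε²)` candidates at squared distance `M ε²` or more leaves the exponent `n ε² (1 + 3/4 - M/4)`. -/

theorem integrable_sqrt_mul_sqrt {f g : α → ℝ} (hf : Measurable f) (hg : Measurable g)
    (hf0 : ∀ x, 0 ≤ f x) (hg0 : ∀ x, 0 ≤ g x) (hfi : Integrable f m) (hgi : Integrable g m) :
    Integrable (fun x => √(f x) * √(g x)) m := by
  refine (hfi.add hgi).mono' (by fun_prop) (.of_forall fun x => ?_)
  rw [Real.norm_of_nonneg (by positivity), Pi.add_apply]
  nlinarith [Real.sq_sqrt (hf0 x), Real.sq_sqrt (hg0 x), sq_nonneg (√(f x) - √(g x)), hf0 x, hg0 x]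

theorem hellingerSq_eq {f g : α → ℝ} (hf : Measurable f) (hg : Measurable g)
    (hf0 : ∀ x, 0 ≤ f x) (hg0 : ∀ x, 0 ≤ g x) (hfi : Integrable f m) (hgi : Integrable g m) :
    hellingerSq m f g = ∫ x, f x ∂m + ∫ x, g x ∂m - 2 * ∫ x, √(f x) * √(g x) ∂m := by
  have hi := integrable_sqrt_mul_sqrt hf hg hf0 hg0 hfi hgi
  have hfg : Integrable (fun x => f x + g x) m := hfi.add hgi
  rw [hellingerSq, ← integral_add hfi hgi, ← integral_const_mul,
    ← integral_sub hfg (hi.const_mul 2)]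
  refine integral_congr_ae (.of_forall fun x => ?_)
  simp only
  nlinarith [Real.sq_sqrt (hf0 x), Real.sq_sqrt (hg0 x)]

/-- The Hellinger affinity of a probability density and a subprobability density. -/
theorem affinity_le_exp {p q : α → ℝ} (hp : IsProbDensity m p) (hq : Measurable q)
    (hq0 : ∀ x, 0 ≤ q x) (hqi : Integrable q m) (hq1 : ∫ x, q x ∂m ≤ 1) :
    ∫ x, √(p x) * √(q x) ∂m ≤ Real.exp (-(hellingerSq m p q / 2)) := by
  have h := hellingerSq_eq hp.measurable hq hp.nonneg hq0 hp.integrable hqi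
  rw [hp.integral_eq_one] at h
  linarith [Real.add_one_le_exp (-(hellingerSq m p q / 2))]

/-- With `s = √a ≤ t = √b`, right side minus left side is exactly `(t - s)³ / t` when `t > 0`. The
linear term `√a * √b - a` is kept explicit because it has to cancel later. -/
theorem mul_sqrt_div_le {a b : ℝ} (ha : 0 ≤ a) (hab : a ≤ b) :
    a * √(a / b) ≤ a - (√a * √b - a) + (a + b - 2 * (√a * √b)) := by
  rw [Real.sqrt_div ha]
  have hs := Real.sq_sqrt ha
  have ht := Real.sq_sqrt (ha.trans hab)
  have h0 := Real.sqrt_nonneg a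
  have hst : √a ≤ √b := Real.sqrt_le_sqrt hab
  rcases (Real.sqrt_nonneg b).eq_or_lt with h | h
  · rw [← h] at hst ht ⊢
    simp only [div_zero, mul_zero]
    nlinarith
  · rw [← mul_div_assoc, div_le_iff₀ h]
    have : 0 ≤ (√b - √a) ^ 3 := pow_nonneg (by linarith) 3
    generalize √a = s at *
    generalize √b = t at *
    subst hs ht
    nlinarith

/-- The half moment of the likelihood ratio of `p` and the renormalization of a function `u ≥ p`
is exponentially small in the squared Hellinger distance of `p` and `u`. -/
theorem integral_mul_sqrt_div_le_exp {p u : α → ℝ} (hp : IsProbDensity m p) (hu : Measurable u)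
    (hui : Integrable u m) (hpu : ∀ x, p x ≤ u x) :
    Integrable (fun x => p x * √(p x / (u x / ∫ y, u y ∂m))) m ∧
    ∫ x, p x * √(p x / (u x / ∫ y, u y ∂m)) ∂m ≤ Real.exp (3 / 2 * hellingerSq m p u) := by
  have hu0 : ∀ x, 0 ≤ u x := fun x => (hp.nonneg x).trans (hpu x)
  have h := hellingerSq_eq hp.measurable hu hp.nonneg hu0 hp.integrable hui
  have hi := integrable_sqrt_mul_sqrt hp.measurable hu hp.nonneg hu0 hp.integrable hui
  have hc1 : 1 ≤ ∫ y, u y ∂m := by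
    rw [← hp.integral_eq_one]
    exact integral_mono hp.integrable hui hpu
  rw [hp.integral_eq_one] at h
  set c := ∫ y, u y ∂m
  set H := hellingerSq m p u
  set b := ∫ x, √(p x) * √(u x) ∂m
  have heq : ∀ x, p x * √(p x / (u x / c)) = √c * (p x * √(p x / u x)) := fun x => by
    rw [div_div_eq_mul_div, mul_comm (p x) c, mul_div_assoc, Real.sqrt_mul (by linarith)]
    ring
  have hbd := fun x => mul_sqrt_div_le (hp.nonneg x) (hpu x)
  have hpm := hp.measurable
  have hp0 := hp.nonneg
  have hdiff : Integrable (fun x => √(p x) * √(u x) - p x) m := hi.sub hp.integrable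
  have hsum : Integrable (fun x => p x + u x) m := hp.integrable.add hui
  have hint₁ : Integrable (fun x => p x - (√(p x) * √(u x) - p x)) m := hp.integrable.sub hdiff
  have hint₂ : Integrable (fun x => p x + u x - 2 * (√(p x) * √(u x))) m :=
    hsum.sub (hi.const_mul 2)
  have hint : Integrable (fun x => p x * √(p x / u x)) m := by
    refine (hint₁.add hint₂).mono' (by fun_prop) (.of_forall fun x => ?_)
    rw [Real.norm_of_nonneg (mul_nonneg (hp0 x) (Real.sqrt_nonneg _))]
    exact hbd x
  have hval : ∫ x, p x * √(p x / u x) ∂m ≤ 1 - (b - 1) + H := by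
    refine (integral_mono hint (hint₁.add hint₂) hbd).trans_eq ?_
    simp only [Pi.add_apply]
    rw [integral_add hint₁ hint₂, integral_sub hp.integrable hdiff,
      integral_sub hi hp.integrable, integral_sub hsum (hi.const_mul 2),
      integral_add hp.integrable hui, integral_const_mul, hp.integral_eq_one, h]
  -- Expanding `H` gives `c = 1 + 2 (b - 1) + H`.
  have hsqrt : √c ≤ Real.exp ((b - 1) + H / 2) := by
    rw [Real.sqrt_le_left (Real.exp_nonneg _), ← Real.exp_nat_mul]
    push_cast
    linarith [Real.add_one_le_exp (2 * ((b - 1) + H / 2))]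
  simp only [heq]
  refine ⟨hint.const_mul _, ?_⟩
  rw [integral_const_mul]
  -- The term `b - 1`, which may be of order `√H`, enters the two factors with opposite signs and
  -- cancels; bounding them separately would lose the rate.
  calc √c * ∫ x, p x * √(p x / u x) ∂m
      ≤ Real.exp ((b - 1) + H / 2) * Real.exp (-(b - 1) + H) := by
        refine mul_le_mul hsqrt ?_ (integral_nonneg fun x => mul_nonneg (hp0 x) (Real.sqrt_nonneg _))
          (Real.exp_nonneg _)
        linarith [Real.add_one_le_exp (-(b - 1) + H)]
    _ = Real.exp (3 / 2 * H) := by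
        rw [← Real.exp_add]
        ring_nf

/-- Bound on the quarter moment, under `p`, of the likelihood ratio of `q` and the renormalization
of a function `u ≥ p`. -/
theorem lintegral_rpow_quarter_le {p q u : α → ℝ} (hp : IsProbDensity m p) (hq : Measurable q)
    (hq0 : ∀ x, 0 ≤ q x) (hqi : Integrable q m) (hq1 : ∫ x, q x ∂m ≤ 1) (hu : Measurable u)
    (hui : Integrable u m) (hpu : ∀ x, p x ≤ u x) :
    ∫⁻ x, ENNReal.ofReal (√(√(q x / (u x / ∫ y, u y ∂m))))
        ∂(m.withDensity fun x => ENNReal.ofReal (p x)) ≤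
      ENNReal.ofReal (Real.exp (-(hellingerSq m p q / 4) + 3 / 4 * hellingerSq m p u)) := by
  have hpm := hp.measurable
  have hp0 := hp.nonneg
  obtain ⟨hBi, hB⟩ := integral_mul_sqrt_div_le_exp hp hu hui hpu
  have hA := affinity_le_exp hp hq hq0 hqi hq1
  have hAi := integrable_sqrt_mul_sqrt hpm hq hp0 hq0 hp.integrable hqi
  set c := ∫ y, u y ∂m
  set A : α → ℝ := fun x => √(p x) * √(q x)
  set B : α → ℝ := fun x => p x * √(p x / (u x / c))
  have hA0 : ∀ x, 0 ≤ A x := fun x => by positivity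
  have hB0 : ∀ x, 0 ≤ B x := fun x => mul_nonneg (hp0 x) (Real.sqrt_nonneg _)
  have hAm : Measurable A := by fun_prop
  have hBm : Measurable B := by fun_prop
  have hsq : ∀ {f : α → ℝ}, (∀ x, 0 ≤ f x) → ∀ x,
      ENNReal.ofReal (√(f x)) ^ (2 : ℝ) = ENNReal.ofReal (f x) := fun hf x => by
    rw [ENNReal.ofReal_rpow_of_nonneg (Real.sqrt_nonneg _) zero_le_two, Real.rpow_two,
      Real.sq_sqrt (hf x)]
  -- Splitting for Cauchy–Schwarz: `A * B = p² √(q / (u / c))`.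
  have hpt : ∀ x, p x * √(√(q x / (u x / c))) = √(A x) * √(B x) := fun x => by
    rw [← Real.sqrt_mul (hA0 x)]
    nth_rw 1 [← Real.sqrt_sq (hp0 x)]
    rw [← Real.sqrt_mul (sq_nonneg _)]
    congr 1
    simp only [A, B]
    rw [Real.sqrt_div (hp0 x), Real.sqrt_div (hq0 x)]
    linear_combination -(p x * √(q x) / √(u x / c)) * Real.sq_sqrt (hp0 x)
  rw [lintegral_withDensity_eq_lintegral_mul _ (by fun_prop) (by fun_prop)]
  calc ∫⁻ x, ((fun x => ENNReal.ofReal (p x)) *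
          fun x => ENNReal.ofReal (√(√(q x / (u x / c))))) x ∂m
      = ∫⁻ x, ((fun x => ENNReal.ofReal (√(A x))) * fun x => ENNReal.ofReal (√(B x))) x ∂m := by
        refine lintegral_congr fun x => ?_
        simp only [Pi.mul_apply]
        rw [← ENNReal.ofReal_mul (hp0 x), ← ENNReal.ofReal_mul (Real.sqrt_nonneg _), hpt]
    _ ≤ (∫⁻ x, ENNReal.ofReal (A x) ∂m) ^ (1 / 2 : ℝ) *
          (∫⁻ x, ENNReal.ofReal (B x) ∂m) ^ (1 / 2 : ℝ) := by
        have := ENNReal.lintegral_mul_le_Lp_mul_Lq m Real.HolderConjugate.two_two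
          (f := fun x => ENNReal.ofReal (√(A x))) (g := fun x => ENNReal.ofReal (√(B x)))
          (by fun_prop) (by fun_prop)
        simpa only [hsq hA0, hsq hB0] using this
    _ ≤ ENNReal.ofReal (Real.exp (-(hellingerSq m p q / 2))) ^ (1 / 2 : ℝ) *
          ENNReal.ofReal (Real.exp (3 / 2 * hellingerSq m p u)) ^ (1 / 2 : ℝ) := by
        rw [← ofReal_integral_eq_lintegral_ofReal hAi (.of_forall hA0),
          ← ofReal_integral_eq_lintegral_ofReal hBi (.of_forall hB0)]
        gcongr
    _ = _ := by
        rw [ENNReal.ofReal_rpow_of_nonneg (Real.exp_nonneg _) (by norm_num),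
          ENNReal.ofReal_rpow_of_nonneg (Real.exp_nonneg _) (by norm_num), ← Real.exp_mul,
          ← Real.exp_mul, ← ENNReal.ofReal_mul (Real.exp_nonneg _), ← Real.exp_add]
        ring_nf

/-! ### Product laws -/

theorem lintegral_pi_prod {ι : Type*} [Fintype ι] {X : ι → Type*} [∀ i, MeasurableSpace (X i)]
    (ν : (i : ι) → Measure (X i)) [∀ i, IsProbabilityMeasure (ν i)] {f : (i : ι) → X i → ℝ≥0∞}
    (hf : ∀ i, Measurable (f i)) :
    ∫⁻ x, ∏ i, f i (x i) ∂Measure.pi ν = ∏ i, ∫⁻ x, f i x ∂ν i := by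
  refine (ProbabilityTheory.lintegral_prod_eq_prod_lintegral_of_indepFun Finset.univ
    (fun i (x : (i : ι) → X i) => f i (x i))
    (ProbabilityTheory.iIndepFun_pi fun i => (hf i).aemeasurable)
    fun i => (hf i).comp (measurable_pi_apply i)).trans ?_
  exact Finset.prod_congr rfl fun i _ => (measurePreserving_eval ν i).lintegral_comp (hf i)

theorem IsProbDensity.isProbabilityMeasure {p : α → ℝ} (hp : IsProbDensity m p) :
    IsProbabilityMeasure (m.withDensity fun x => ENNReal.ofReal (p x)) := by
  refine ⟨?_⟩
  rw [withDensity_apply _ MeasurableSet.univ, setLIntegral_univ,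
    ← ofReal_integral_eq_lintegral_ofReal hp.integrable (.of_forall hp.nonneg),
    hp.integral_eq_one, ENNReal.ofReal_one]

theorem sqrt_sqrt_prod {ι : Type*} (s : Finset ι) {f : ι → ℝ} (hf : ∀ i ∈ s, 0 ≤ f i) :
    √(√(∏ i ∈ s, f i)) = ∏ i ∈ s, √(√(f i)) := by
  simp only [Real.sqrt_eq_rpow]
  rw [← Real.finsetProd_rpow s f hf,
    ← Real.finsetProd_rpow s _ fun i hi => Real.rpow_nonneg (hf i hi) _]

variable {n : ℕ} {X : Fin n → Type*} [∀ i, MeasurableSpace (X i)] {μ : (i : Fin n) → Measure (X i)}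

theorem law_ae_pos {p : ProductDensity X} [∀ i, SigmaFinite (μ i)]
    (hp : ∀ i, IsProbDensity (μ i) (p i)) : ∀ᵐ x ∂p.law μ, ∀ i, 0 < p i (x i) := by
  have := fun i => (hp i).isProbabilityMeasure
  refine eventually_all.2 fun i => ?_
  have h : ∀ᵐ y ∂(μ i).withDensity fun x => ENNReal.ofReal (p i x), 0 < p i y := by
    rw [ae_withDensity_iff (hp i).measurable.ennreal_ofReal]
    refine .of_forall fun y hy => ?_
    simpa using hy
  exact (Measure.tendsto_eval_ae_ae
    (μ := fun i => (μ i).withDensity fun x => ENNReal.ofReal (p i x))).eventually h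

/-! ### Posterior bounds at fixed sample size -/

/-- The posterior mass is bounded by a sum of fourth roots of likelihood ratios. -/
theorem posterior_bracketPrior_le {N : ℕ} (u : Fin N → (i : Fin n) → X i → ℝ) (k : Fin N)
    (B : Set (ProductDensity X)) (x : (i : Fin n) → X i)
    (h0 : ∀ j, 0 ≤ (renormalize μ (u j)).joint x) (hk : 0 < (renormalize μ (u k)).joint x) :
    posterior (bracketPrior μ u) B x ≤
      ∑ j, B.indicator (fun q => ENNReal.ofReal (√(√(q.joint x / (renormalize μ (u k)).joint x))))
        (renormalize μ (u j)) := by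
  have hN : (N : ℝ≥0∞) ≠ 0 := by
    have := k.pos
    exact_mod_cast this.ne'
  have hmeas : ∀ f : ProductDensity X → ℝ≥0∞, Measurable f := fun f => measurable_from_top
  have hB : MeasurableSet B := MeasurableSpace.measurableSet_top
  set J : Fin N → ℝ := fun j => (renormalize μ (u j)).joint x with hJ
  have hden : ∫⁻ q, ENNReal.ofReal (q.joint x) ∂bracketPrior μ u =
      (N : ℝ≥0∞)⁻¹ * ∑ j, ENNReal.ofReal (J j) := by
    rw [bracketPrior, lintegral_smul_measure, lintegral_finsetSum_measure]
    simp only [lintegral_dirac' _ (hmeas _), smul_eq_mul, hJ]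
  have hnum : ∫⁻ q in B, ENNReal.ofReal (q.joint x) ∂bracketPrior μ u =
      (N : ℝ≥0∞)⁻¹ * ∑ j, B.indicator (fun q => ENNReal.ofReal (q.joint x))
        (renormalize μ (u j)) := by
    rw [← lintegral_indicator hB, bracketPrior, lintegral_smul_measure,
      lintegral_finsetSum_measure]
    simp only [lintegral_dirac' _ (hmeas _), smul_eq_mul]
  rw [posterior, hnum, hden, ENNReal.mul_div_mul_left _ _
    (ENNReal.inv_ne_zero.2 (ENNReal.natCast_ne_top N)) (ENNReal.inv_ne_top.2 hN),
    div_eq_mul_inv, Finset.sum_mul]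
  refine Finset.sum_le_sum fun j _ => ?_
  by_cases hj : renormalize μ (u j) ∈ B
  · rw [Set.indicator_of_mem hj, Set.indicator_of_mem hj, ← div_eq_mul_inv]
    change ENNReal.ofReal (J j) / _ ≤ ENNReal.ofReal (√(√(J j / J k)))
    have hsingle : ∀ l, ENNReal.ofReal (J l) ≤ ∑ j, ENNReal.ofReal (J j) := fun l =>
      Finset.single_le_sum (f := fun j => ENNReal.ofReal (J j)) (fun _ _ => zero_le)
        (Finset.mem_univ l)
    have hr : 0 ≤ J j / J k := div_nonneg (h0 j) hk.le
    -- The posterior weight is at most `min 1 r` with `r = J j / J k`, and `min 1 r ≤ r ^ (1/4)`.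
    rcases le_total (J j / J k) 1 with h1 | h1
    · refine (ENNReal.div_le_div_left (hsingle k) _).trans ?_
      rw [← ENNReal.ofReal_div_of_pos hk]
      refine ENNReal.ofReal_le_ofReal ?_
      have aux : ∀ {t : ℝ}, 0 ≤ t → t ≤ 1 → t ≤ √t := fun {t} ht ht1 =>
        Real.le_sqrt_of_sq_le (by nlinarith)
      have := aux hr h1
      exact this.trans (aux (Real.sqrt_nonneg _) (Real.sqrt_le_one.2 h1))
    · refine (ENNReal.div_le_of_le_mul (b := 1) (by simpa using hsingle j)).trans ?_
      rw [← ENNReal.ofReal_one]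
      refine ENNReal.ofReal_le_ofReal ?_
      rw [Real.one_le_sqrt, Real.one_le_sqrt]
      exact h1
  · simp [hj]

/-- Posterior contraction at finite sample size. -/
theorem lintegral_posterior_le [∀ i, SigmaFinite (μ i)] {p : ProductDensity X}
    (hp : ∀ i, IsProbDensity (μ i) (p i)) {N : ℕ} {u : Fin N → (i : Fin n) → X i → ℝ}
    (hum : ∀ j i, Measurable (u j i)) (hu0 : ∀ j i x, 0 ≤ u j i x)
    (hui : ∀ j i, Integrable (u j i) (μ i)) (k : Fin N) (hk : ∀ i x, p i x ≤ u k i x)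
    (B : Set (ProductDensity X)) {b : ℝ}
    (hB : ∀ q ∈ B, b ≤ ∑ i, hellingerSq (μ i) (p i) (q i)) :
    ∫⁻ x, posterior (bracketPrior μ u) B x ∂p.law μ ≤
      N * ENNReal.ofReal
        (Real.exp (-(b / 4) + 3 / 4 * ∑ i, hellingerSq (μ i) (p i) (u k i))) := by
  have hprob := fun i => (hp i).isProbabilityMeasure
  have hc0 : ∀ j i, 0 ≤ ∫ y, u j i y ∂μ i := fun j i => integral_nonneg (hu0 j i)
  have hck : ∀ i, 0 < ∫ y, u k i y ∂μ i := fun i => by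
    have := integral_mono (hp i).integrable (hui k i) (hk i)
    rw [(hp i).integral_eq_one] at this
    linarith
  have hr0 : ∀ j i x, 0 ≤ renormalize μ (u j) i x := fun j i x => div_nonneg (hu0 j i x) (hc0 j i)
  have hrm : ∀ j i, Measurable (renormalize μ (u j) i) := fun j i => (hum j i).div_const _
  have hri : ∀ j i, Integrable (renormalize μ (u j) i) (μ i) := fun j i => (hui j i).div_const _
  -- Only `≤ 1`: a bracket component of integral zero renormalizes to the zero function, as division
  -- by zero gives zero.
  have hr1 : ∀ j i, ∫ x, renormalize μ (u j) i x ∂μ i ≤ 1 := fun j i => by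
    simp only [renormalize]
    rw [integral_div]
    exact div_self_le_one _
  have hsplit : ∀ j x, ENNReal.ofReal (√(√((renormalize μ (u j)).joint x /
      (renormalize μ (u k)).joint x))) = ∏ i, ENNReal.ofReal
        (√(√(renormalize μ (u j) i (x i) / (u k i (x i) / ∫ y, u k i y ∂μ i)))) := fun j x => by
    rw [ProductDensity.joint, ProductDensity.joint, ← Finset.prod_div_distrib,
      sqrt_sqrt_prod _ fun i _ => div_nonneg (hr0 j i _) (hr0 k i _),
      ENNReal.ofReal_prod_of_nonneg fun i _ => Real.sqrt_nonneg _]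
    rfl
  have hmeas : ∀ j i, Measurable fun x => ENNReal.ofReal
      (√(√(renormalize μ (u j) i x / (u k i x / ∫ y, u k i y ∂μ i)))) := fun j i => by
    have := hrm j i
    have := hum k i
    fun_prop
  calc ∫⁻ x, posterior (bracketPrior μ u) B x ∂p.law μ
      ≤ ∫⁻ x, ∑ j, B.indicator (fun q => ENNReal.ofReal
          (√(√(q.joint x / (renormalize μ (u k)).joint x)))) (renormalize μ (u j)) ∂p.law μ := by
        refine lintegral_mono_ae ?_
        filter_upwards [law_ae_pos hp] with x hx
        -- Bracket `k` dominates `p`, so its joint density is positive wherever all components of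
        -- `p` are, hence almost surely.
        exact posterior_bracketPrior_le u k B x
          (fun j => Finset.prod_nonneg fun i _ => hr0 j i _)
          (Finset.prod_pos fun i _ => div_pos ((hx i).trans_le (hk i _)) (hck i))
    _ = ∑ j, ∫⁻ x, B.indicator (fun q => ENNReal.ofReal
          (√(√(q.joint x / (renormalize μ (u k)).joint x)))) (renormalize μ (u j)) ∂p.law μ := by
        refine lintegral_finsetSum _ fun j _ => ?_
        by_cases hj : renormalize μ (u j) ∈ B
        · simp only [Set.indicator_of_mem hj, hsplit]
          exact Finset.measurable_fun_prod _ fun i _ => (hmeas j i).comp (measurable_pi_apply i)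
        · simp only [Set.indicator_of_notMem hj, measurable_const]
    _ ≤ ∑ _j : Fin N, ENNReal.ofReal
          (Real.exp (-(b / 4) + 3 / 4 * ∑ i, hellingerSq (μ i) (p i) (u k i))) := by
        refine Finset.sum_le_sum fun j _ => ?_
        by_cases hj : renormalize μ (u j) ∈ B
        · simp only [Set.indicator_of_mem hj, hsplit]
          rw [ProductDensity.law, lintegral_pi_prod _ (hmeas j)]
          refine (Finset.prod_le_prod' fun i _ => lintegral_rpow_quarter_le (hp i) (hrm j i)
            (hr0 j i) (hri j i) (hr1 j i) (hum k i) (hui k i) (hk i)).trans ?_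
          rw [← ENNReal.ofReal_prod_of_nonneg fun i _ => Real.exp_nonneg _, ← Real.exp_sum]
          refine ENNReal.ofReal_le_ofReal (Real.exp_le_exp.2 ?_)
          rw [Finset.sum_add_distrib, ← Finset.mul_sum, Finset.sum_neg_distrib, ← Finset.sum_div]
          have := hB _ hj
          linarith
        · simp [Set.indicator_of_notMem hj]
    _ = _ := by simp

end FiniteSieve

/-! ### Asymptotics -/

theorem theorem8 {Θ : Type*} {X : (n : ℕ) → Fin n → Type*} [∀ n i, MeasurableSpace (X n i)]
    (μ : (n : ℕ) → (i : Fin n) → Measure (X n i)) [∀ n i, SigmaFinite (μ n i)]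
    (p : (n : ℕ) → Θ → FiniteSieve.ProductDensity (X n))
    (hp : ∀ n θ i, FiniteSieve.IsProbDensity (μ n i) (p n θ i))
    (S : ℕ → Set Θ) (hS_mono : Monotone S) (hS_union : ⋃ n, S n = Set.univ)
    (θ₀ : Θ)
    (ε : ℕ → ℝ) (hε : Tendsto ε atTop (𝓝 0))
    (hnε : Tendsto (fun n : ℕ => (n : ℝ) * ε n ^ 2) atTop atTop)
    (hlog : ∀ n : ℕ, 0 < n →
      ENNReal.log (FiniteSieve.upperBracketingNumber (μ n) (p n) (ε n) (S n) : ℝ≥0∞) ≤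
        (((n : ℝ) * ε n ^ 2 : ℝ) : EReal))
    (N : ℕ → ℕ)
    (hN : ∀ n : ℕ, 0 < n →
      (N n : ℕ∞) = FiniteSieve.upperBracketingNumber (μ n) (p n) (ε n) (S n))
    (u : (n : ℕ) → Fin (N n) → (i : Fin n) → X n i → ℝ)
    (hu : ∀ n : ℕ, 0 < n → FiniteSieve.IsUpperBracketing (μ n) (p n) (ε n) (S n) (u n)) :
    ∃ M₀ : ℝ, ∀ M : ℝ, M₀ ≤ M →
      Tendsto
        (fun n : ℕ =>
          ∫⁻ x, FiniteSieve.posterior (FiniteSieve.bracketPrior (μ n) (u n))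
              {q | M * ε n ^ 2 ≤ FiniteSieve.avgHellingerSq (μ n) (p n θ₀) q} x
            ∂(p n θ₀).law (μ n))
        atTop (𝓝 0) := by
  -- Any `M > 7` would do; `8` makes the exponent at most `-n ε² / 4`.
  refine ⟨8, fun M hM => ?_⟩
  have hlim : Tendsto (fun n : ℕ => ENNReal.ofReal (Real.exp (-(((n : ℝ) * ε n ^ 2) / 4))))
      atTop (𝓝 0) := by
    rw [← ENNReal.ofReal_zero]
    exact ENNReal.tendsto_ofReal
      (Real.tendsto_exp_neg_atTop_nhds_zero.comp (hnε.atTop_div_const (by norm_num)))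
  refine tendsto_of_tendsto_of_tendsto_of_le_of_le' tendsto_const_nhds hlim
    (.of_forall fun _ => zero_le) ?_
  obtain ⟨m, hm⟩ := Set.mem_iUnion.1 (hS_union ▸ Set.mem_univ θ₀)
  filter_upwards [eventually_ge_atTop m, eventually_gt_atTop 0] with n hmn hn
  have hn' : (0 : ℝ) < n := Nat.cast_pos.2 hn
  obtain ⟨k, hk, hH⟩ := (hu n hn).covers θ₀ (hS_mono hmn hm)
  have hNle : (N n : ℝ≥0∞) ≤ ENNReal.ofReal (Real.exp ((n : ℝ) * ε n ^ 2)) := by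
    have h := hlog n hn
    rw [← hN n hn, ENat.toENNReal_coe] at h
    rw [← ENNReal.log_le_log_iff, ENNReal.log_ofReal_of_pos (Real.exp_pos _), Real.log_exp]
    exact h
  refine (FiniteSieve.lintegral_posterior_le (hp n θ₀) (hu n hn).measurable (hu n hn).nonneg
    (hu n hn).integrable k hk _ (b := n * (M * ε n ^ 2)) fun q hq => ?_).trans ?_
  · have h : M * ε n ^ 2 ≤ 1 / (n : ℝ) * ∑ i, FiniteSieve.hellingerSq (μ n i) (p n θ₀ i) (q i) := hq
    rwa [one_div, ← div_eq_inv_mul, le_div_iff₀ hn', mul_comm] at h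
  · refine (mul_le_mul_left hNle _).trans ?_
    rw [← ENNReal.ofReal_mul (Real.exp_nonneg _), ← Real.exp_add]
    refine ENNReal.ofReal_le_ofReal (Real.exp_le_exp.2 ?_)
    have : 0 ≤ (M - 8) * ((n : ℝ) * ε n ^ 2) := mul_nonneg (by linarith) (by positivity)
    linarith
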